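/- Let $m$ be a positive integer and $n=3^m-1$. For an integer $s$ with $0\le s\le n-1$, let $C_s=\{\,s\cdot 3^j \bmod n : j\ge 0\,\}\subseteq\{0,1,\dots,n-1\}$ be the $3$-cyclotomic coset of $s$ modulo $n$, and call the smallest integer in the set $\{k,\,n-k : k\in C_s\}$ the absolute coset leader of $C_s$. An integer is the third largest absolute coset leader if it is the absolute coset leader of some $C_s$ with $0\le s\le n-1$ and exactly two larger integers are absolute coset leaders of such cosets. (1) If $m\equiv 0\pmod 4$ and $m\ge 4$, then $5\mid 3^m-1$, and $\delta_3=\frac{3^m-1}{5}$ is the third largest absolute coset leader, $C_{\delta_3}=\{\delta_3,\,2\delta_3,\,n-2\delta_3,\,n-\delta_3\}$, and $|C_{\delta_3}|=4$. (2) If $m\equiv 2\pmod 4$ and $m\ge 6$, then $5\mid 3^{m-6}-1$, and $$\delta_3=\frac{3^{m-6}-1}{5}+3^{m-6}+2\cdot 3^{m-5}+2\cdot 3^{m-3}+3^{m-2}$$ is the third largest absolute coset leader, $C_{\delta_3}\ne C_{n-\delta_3}$, and $|C_{\delta_3}|=|C_{n-\delta_3}|=m$. -/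

import Mathlib

/-- The `q`-cyclotomic coset of `s` modulo `n`: the set of residues in `{0, …, n - 1}` of
`s, s q, s q², …`. (For `q` coprime to `n` the sequence is periodic from the start, so running
over all exponents gives the same set as stopping at the first return to `s`.) -/
def cyclotomicCoset (q n s : ℕ) : Set ℕ :=
  {k | ∃ j : ℕ, k = s * q ^ j % n}

/-- The absolute coset leader of the coset of `s`: the smallest integer in
`{k, n - k : k ∈ C_s}`. (This set is never empty, and every `k ∈ C_s` satisfies `k < n`
when `n` is positive.) -/
noncomputable def absCosetLeader (q n s : ℕ) : ℕ :=
  sInf {a | ∃ k ∈ cyclotomicCoset q n s, a = k ∨ a = n - k}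

/-- The set of absolute coset leaders of all `q`-cyclotomic cosets modulo `n`. -/
def absCosetLeaders (q n : ℕ) : Set ℕ :=
  {a | ∃ s < n, a = absCosetLeader q n s}

/-- `a` is the `k`-th largest element of `A`: it belongs to `A`, and exactly `k - 1` elements
of `A` are larger. -/
def IsKthLargest (k : ℕ) (A : Set ℕ) (a : ℕ) : Prop :=
  a ∈ A ∧ {b ∈ A | a < b}.encard + 1 = k

/-!
For a residue `x` modulo `n`, let `circleDist n x` be its distance to `0` on the circle `ℤ / n`.
The absolute coset leader of `s` is the least value of the orbit `y j = circleDist n (s * 3 ^ j)`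
(`isLeast_absCosetLeader`). This orbit follows the folded tripling map on `[0, n / 2]`
(`circleDist_step`) and has period `m` because `3 ^ m ≡ 1` modulo `n` (`circleDist_add_period`).

* If the whole orbit lies strictly above `n / 5`, it is constant, equal to `n / 2` or `n / 4`
  (`constant_of_forall_gt_fifth`): such an orbit stays near one of these two fixed points, the map
  multiplies the deviation from the fixed point by `± 3`, and periodicity makes the deviation
  vanish. For `4 ∣ m` the point `n / 5` is itself a leader, so it comes third.
* If `m ≡ 2` modulo `4`, then `5 ∤ n` and the third leader is `δ = (n - 2 * 3 ^ (m - 4)) / 5`,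
  slightly below `n / 5`. An orbit above `δ` cannot have a value below `n / 5`
  (`gt_fifth_of_forall_gt`): four steps lead from such a value to another one, while two steps
  lead to a value above `n / 5`; both conflict since `m + 2` is a multiple of `4`. The orbit of `δ`
  itself is computed through the deviations `5 * y j - n`, which are multiplied by `-9` every two
  steps; it meets `δ` once per period and otherwise stays above it (`orbit_gt_of_lt_period`), which
  also gives the sizes of the cosets.
-/

/-! ### Distance to zero on the circle -/

/-- The distance from the residue of `x` to `0` on the circle of integers modulo `n`. -/
def circleDist (n x : ℕ) : ℕ := min (x % n) (n - x % n)

lemma circleDist_of_two_mul_le {n x : ℕ} (hn : 0 < n) (h : 2 * x ≤ n) : circleDist n x = x := by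
  have : x % n = x := Nat.mod_eq_of_lt (by omega)
  unfold circleDist
  omega

lemma circleDist_mod (n x : ℕ) : circleDist n (x % n) = circleDist n x := by
  simp [circleDist]

lemma two_mul_circleDist_le (n x : ℕ) : 2 * circleDist n x ≤ n := by
  rcases Nat.eq_zero_or_pos n with rfl | hn
  · simp [circleDist]
  · have := Nat.mod_lt x hn
    unfold circleDist
    omega

lemma circleDist_three_mul {n : ℕ} (hn : 0 < n) (x : ℕ) :
    circleDist n (3 * x) = 3 * circleDist n x ∨
      circleDist n (3 * x) + 3 * circleDist n x = n ∨
      circleDist n (3 * x) + n = 3 * circleDist n x := by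
  have hr := Nat.mod_lt x hn
  have h3 : 3 * x % n = 3 * (x % n) % n := by simp [Nat.mul_mod]
  have hcases : 3 * (x % n) % n = 3 * (x % n) ∨ 3 * (x % n) % n + n = 3 * (x % n) ∧ n ≤ 3 * (x % n)
      ∨ 3 * (x % n) % n + 2 * n = 3 * (x % n) := by
    have h1 := Nat.div_add_mod (3 * (x % n)) n
    have h2 : 3 * (x % n) / n < 3 := Nat.div_lt_of_lt_mul (by linarith)
    interval_cases h : 3 * (x % n) / n <;> omega
  have h4 := Nat.mod_lt (3 * x) hn
  unfold circleDist
  rw [h3] at *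
  generalize 3 * (x % n) % n = z at *
  omega

/-- The folded tripling map: each orbit value determines the next one. -/
lemma circleDist_step {n : ℕ} (hn : 0 < n) (s j : ℕ) :
    2 * circleDist n (s * 3 ^ (j + 1)) ≤ n ∧
      (circleDist n (s * 3 ^ (j + 1)) = 3 * circleDist n (s * 3 ^ j) ∨
      circleDist n (s * 3 ^ (j + 1)) + 3 * circleDist n (s * 3 ^ j) = n ∨
      circleDist n (s * 3 ^ (j + 1)) + n = 3 * circleDist n (s * 3 ^ j)) := by
  refine ⟨two_mul_circleDist_le _ _, ?_⟩
  have : s * 3 ^ (j + 1) = 3 * (s * 3 ^ j) := by ring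
  rw [this]
  exact circleDist_three_mul hn _

lemma mul_pow_add_period_mod {n m : ℕ} (hm : n + 1 = 3 ^ m) (s j : ℕ) :
    s * 3 ^ (j + m) % n = s * 3 ^ j % n := by
  have : s * 3 ^ (j + m) = s * 3 ^ j + n * (s * 3 ^ j) := by rw [pow_add, ← hm]; ring
  rw [this, Nat.add_mul_mod_self_left]

lemma circleDist_add_period {n m : ℕ} (hm : n + 1 = 3 ^ m) (s j : ℕ) :
    circleDist n (s * 3 ^ (j + m)) = circleDist n (s * 3 ^ j) := by
  rw [← circleDist_mod, mul_pow_add_period_mod hm, circleDist_mod]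

lemma mul_pow_mod_period {n m : ℕ} (hm : n + 1 = 3 ^ m) (s j : ℕ) :
    s * 3 ^ j % n = s * 3 ^ (j % m) % n := by
  have hper : Function.Periodic (fun j => s * 3 ^ j % n) m := mul_pow_add_period_mod hm s
  exact (hper.map_mod_nat j).symm

lemma circleDist_mod_period {n m : ℕ} (hm : n + 1 = 3 ^ m) (s j : ℕ) :
    circleDist n (s * 3 ^ j) = circleDist n (s * 3 ^ (j % m)) := by
  rw [← circleDist_mod, mul_pow_mod_period hm, circleDist_mod]

/-! ### Absolute coset leaders as orbit minima -/

lemma isLeast_absCosetLeader (q n s : ℕ) :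
    IsLeast (Set.range fun j => circleDist n (s * q ^ j)) (absCosetLeader q n s) := by
  have hle : ∀ k ∈ cyclotomicCoset q n s,
      absCosetLeader q n s ≤ k ∧ absCosetLeader q n s ≤ n - k := fun k hk =>
    ⟨Nat.sInf_le ⟨k, hk, Or.inl rfl⟩, Nat.sInf_le ⟨k, hk, Or.inr rfl⟩⟩
  have hlow : ∀ j, absCosetLeader q n s ≤ circleDist n (s * q ^ j) := fun j =>
    le_min (hle _ ⟨j, rfl⟩).1 (hle _ ⟨j, rfl⟩).2
  have hmem : absCosetLeader q n s ∈ {a | ∃ k ∈ cyclotomicCoset q n s, a = k ∨ a = n - k} :=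
    Nat.sInf_mem ⟨_, _, ⟨0, rfl⟩, Or.inl rfl⟩
  refine ⟨?_, by rintro _ ⟨j, rfl⟩; exact hlow j⟩
  obtain ⟨k, ⟨j, rfl⟩, hk⟩ := hmem
  refine ⟨j, le_antisymm ?_ (hlow j)⟩
  rcases hk with hk | hk
  · rw [hk]; exact min_le_left _ _
  · rw [hk]; exact min_le_right _ _

/-- A point of `[0, n / 2]` whose orbit never goes below it is an absolute coset leader. -/
lemma mem_absCosetLeaders {n a : ℕ} (hn : 0 < n) (ha : 2 * a ≤ n)
    (h : ∀ j, a ≤ circleDist n (a * 3 ^ j)) : a ∈ absCosetLeaders 3 n := by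
  have hleast : IsLeast (Set.range fun j => circleDist n (a * 3 ^ j)) a := by
    refine ⟨⟨0, by simpa using circleDist_of_two_mul_le hn ha⟩, ?_⟩
    rintro _ ⟨j, rfl⟩
    exact h j
  exact ⟨a, by omega, hleast.unique (isLeast_absCosetLeader 3 n a)⟩

/-! ### Orbits above a fifth of the modulus -/

lemma eq_zero_of_neg_three_pow_mul_eq {m : ℕ} (hm : m ≠ 0) {a : ℤ} (h : (-3) ^ m * a = a) :
    a = 0 := by
  by_contra ha
  have h1 : (-3 : ℤ) ^ m = 1 := mul_right_cancel₀ ha (by rw [h, one_mul])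
  have h2 := congrArg Int.natAbs h1
  rw [Int.natAbs_pow] at h2
  exact absurd h2 (Nat.one_lt_pow hm (by norm_num)).ne'

lemma constant_of_forall_gt_fifth {n m : ℕ} (hm0 : m ≠ 0) (hn : 0 < n) (hm : n + 1 = 3 ^ m)
    (s : ℕ) (h : ∀ j, n < 5 * circleDist n (s * 3 ^ j)) :
    (∀ j, 2 * circleDist n (s * 3 ^ j) = n) ∨ ∀ j, 4 * circleDist n (s * 3 ^ j) = n := by
  have step := circleDist_step hn s
  have hper := circleDist_add_period hm s
  generalize hy : (fun j => circleDist n (s * 3 ^ j)) = y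
  have hy' : ∀ j, circleDist n (s * 3 ^ j) = y j := fun j => congrFun hy j
  simp only [hy'] at *
  by_cases hlow : ∃ i, 3 * y i < n
  · right
    obtain ⟨i, hi⟩ := hlow
    -- From a value below `n / 3` on, the orbit never leaves `(n / 5, n / 3)`.
    have hstay : ∀ k, 3 * y (i + k) < n ∧ (4 * y (i + k) - n : ℤ) = (-3) ^ k * (4 * y i - n) := by
      intro k
      induction k with
      | zero => simpa using hi
      | succ k ih =>
        have h0 := h (i + k)
        have h1 := h (i + k + 1)
        have h2 := h (i + k + 1 + 1)
        have s1 := step (i + k)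
        have s2 := step (i + k + 1)
        have e : i + (k + 1) = i + k + 1 := rfl
        have hlin : (4 * y (i + k + 1) - n : ℤ) = (-3) * (4 * y (i + k) - n) := by omega
        refine ⟨by rw [e]; omega, ?_⟩
        rw [e, hlin, ih.2]
        ring
    have hi0 : (4 * y i - n : ℤ) = 0 :=
      eq_zero_of_neg_three_pow_mul_eq hm0 (by rw [← (hstay m).2, hper])
    have hfix : ∀ k, 4 * y (i + k) = n := by
      intro k
      have := (hstay k).2
      rw [hi0, mul_zero] at this
      omega
    intro j
    have hmul : y j = y (j + i * m) := ((show Function.Periodic y m from hper).nat_mul i j).symm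
    have hge : i ≤ j + i * m :=
      (Nat.le_mul_of_pos_right i (Nat.pos_of_ne_zero hm0)).trans (Nat.le_add_left _ _)
    obtain ⟨k, hk⟩ := Nat.exists_eq_add_of_le hge
    rw [hmul, hk]
    exact hfix k
  · left
    push Not at hlow
    intro j
    have hexp : ∀ k, (n - 2 * y (j + k) : ℤ) = 3 ^ k * (n - 2 * y j) := by
      intro k
      induction k with
      | zero => simp
      | succ k ih =>
        have h0 := hlow (j + k)
        have h1 := hlow (j + k + 1)
        have s1 := step (j + k)
        have e : j + (k + 1) = j + k + 1 := rfl
        have hlin : (n - 2 * y (j + k + 1) : ℤ) = 3 * (n - 2 * y (j + k)) := by omega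
        rw [e, hlin, ih]
        ring
    -- The deviation triples without a sign change, so two periods give the factor `(-3) ^ (2 * m)`.
    have h2m : (n - 2 * y j : ℤ) = 0 := by
      refine eq_zero_of_neg_three_pow_mul_eq (m := 2 * m) (by omega) ?_
      have := hexp (2 * m)
      rw [show j + 2 * m = j + m + m by ring, hper, hper] at this
      rw [pow_mul, neg_pow_two, ← pow_mul, ← this]
    omega

lemma half_mem_absCosetLeaders {n a : ℕ} (hn : 0 < n) (ha : 2 * a = n) :
    a ∈ absCosetLeaders 3 n := by
  refine mem_absCosetLeaders hn ha.le fun j => ?_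
  have : circleDist n (a * 3 ^ j) = a := by
    induction j with
    | zero => simpa using circleDist_of_two_mul_le hn ha.le
    | succ j ih =>
      have := circleDist_step hn a j
      omega
  exact this.ge

lemma quarter_mem_absCosetLeaders {n a : ℕ} (hn : 0 < n) (ha : 4 * a = n) :
    a ∈ absCosetLeaders 3 n := by
  refine mem_absCosetLeaders hn (by omega) fun j => ?_
  have : circleDist n (a * 3 ^ j) = a := by
    induction j with
    | zero => simpa using circleDist_of_two_mul_le hn (by omega)
    | succ j ih =>
      have := circleDist_step hn a j
      omega
  exact this.ge

/-- A leader `δ ≤ n / 5` is the third largest one as soon as every orbit above `δ` is above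
`n / 5`, because then only `n / 2` and `n / 4` beat it. -/
lemma isKthLargest_three {n m δ : ℕ} (hm0 : m ≠ 0) (hm : n + 1 = 3 ^ m) (h4 : 4 ∣ n) (hn : 0 < n)
    (hδ : 5 * δ ≤ n) (hmem : δ ∈ absCosetLeaders 3 n)
    (h : ∀ s, (∀ j, δ < circleDist n (s * 3 ^ j)) → ∀ j, n < 5 * circleDist n (s * 3 ^ j)) :
    IsKthLargest 3 (absCosetLeaders 3 n) δ := by
  refine ⟨hmem, ?_⟩
  obtain ⟨a, ha⟩ := h4
  have hset : {b ∈ absCosetLeaders 3 n | δ < b} = {a, 2 * a} := by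
    ext b
    simp only [Set.mem_insert_iff, Set.mem_singleton_iff, Set.mem_ofPred_eq]
    constructor
    · rintro ⟨⟨s, -, rfl⟩, hb⟩
      obtain ⟨⟨j, hj⟩, hlow⟩ := isLeast_absCosetLeader 3 n s
      have hgt : ∀ j, δ < circleDist n (s * 3 ^ j) := fun j => hb.trans_le (hlow ⟨j, rfl⟩)
      simp only at hj
      rcases constant_of_forall_gt_fifth hm0 hn hm s (h s hgt) with hc | hc <;>
      · have := hc j
        omega
    · rintro (rfl | rfl)
      · exact ⟨quarter_mem_absCosetLeaders hn ha.symm, by omega⟩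
      · exact ⟨half_mem_absCosetLeaders hn (by omega), by omega⟩
  rw [hset, Set.encard_pair (by omega)]
  norm_num

/-! ### Cosets of a fifth of the modulus -/

lemma cyclotomicCoset_fifth {δ : ℕ} :
    cyclotomicCoset 3 (5 * δ) δ = {δ, 2 * δ, 5 * δ - 2 * δ, 5 * δ - δ} := by
  have hval : ∀ j, δ * 3 ^ j % (5 * δ) = δ * (3 ^ (j % 4) % 5) := by
    intro j
    rw [mul_comm 5 δ, Nat.mul_mod_mul_left]
    congr 1
    conv_lhs => rw [← Nat.div_add_mod j 4, pow_add, pow_mul, Nat.mul_mod, Nat.pow_mod]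
    norm_num
  ext k
  simp only [cyclotomicCoset, Set.mem_ofPred_eq, Set.mem_insert_iff, Set.mem_singleton_iff, hval]
  constructor
  · rintro ⟨j, rfl⟩
    have : j % 4 < 4 := Nat.mod_lt _ (by norm_num)
    interval_cases j % 4 <;> norm_num <;> omega
  · rintro (rfl | rfl | rfl | rfl)
    · exact ⟨0, by norm_num⟩
    · exact ⟨3, by norm_num; omega⟩
    · exact ⟨1, by norm_num; omega⟩
    · exact ⟨2, by norm_num; omega⟩

lemma ncard_cyclotomicCoset_fifth {δ : ℕ} (hδ : 0 < δ) :
    (cyclotomicCoset 3 (5 * δ) δ).ncard = 4 := by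
  have hfin : cyclotomicCoset 3 (5 * δ) δ =
      (({δ, 2 * δ, 5 * δ - 2 * δ, 5 * δ - δ} : Finset ℕ) : Set ℕ) := by
    rw [cyclotomicCoset_fifth]; push_cast; rfl
  rw [hfin, Set.ncard_coe_finset]
  rw [Finset.card_insert_of_notMem, Finset.card_insert_of_notMem, Finset.card_insert_of_notMem,
    Finset.card_singleton] <;>
  · simp only [Finset.mem_insert, Finset.mem_singleton]
    omega

lemma fifth_mem_absCosetLeaders {δ : ℕ} (hδ : 0 < δ) : δ ∈ absCosetLeaders 3 (5 * δ) := by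
  refine mem_absCosetLeaders (by omega) (by omega) fun j => ?_
  have : circleDist (5 * δ) (δ * 3 ^ j) = δ ∨ circleDist (5 * δ) (δ * 3 ^ j) = 2 * δ := by
    induction j with
    | zero => left; simpa using circleDist_of_two_mul_le (n := 5 * δ) (by omega) (by omega)
    | succ j ih =>
      have := circleDist_step (n := 5 * δ) (by omega) δ j
      omega
  omega

/-! ### The leader slightly below a fifth of the modulus -/

/-- With `e = 5 * y j - n < 0`, the deviation is `-9 * e` two steps later. Two further steps make it
`81 * e` or `-2 * n - 81 * e`, depending on the branch of the folded map; the latter is at most `1`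
because `e > -2 * t` and `n + 1 = 81 * t`, and divisibility by `5` then makes it negative. -/
lemma lt_fifth_four_steps {n t δ s : ℕ} (hnt : n + 1 = 81 * t)
    (hδ : 5 * δ + 2 * t = n) (h : ∀ j, δ < circleDist n (s * 3 ^ j)) {j : ℕ}
    (hj : 5 * circleDist n (s * 3 ^ j) < n) :
    n < 5 * circleDist n (s * 3 ^ (j + 2)) ∧ 5 * circleDist n (s * 3 ^ (j + 4)) < n := by
  have hn : 0 < n := by omega
  have h0 := h j
  have e1 : circleDist n (s * 3 ^ (j + 1)) + 3 * circleDist n (s * 3 ^ j) = n := by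
    have := circleDist_step hn s j
    omega
  have e2 : circleDist n (s * 3 ^ (j + 2)) + n = 3 * circleDist n (s * 3 ^ (j + 1)) := by
    have := circleDist_step hn s (j + 1)
    simp only [add_assoc, Nat.reduceAdd] at this
    omega
  have e3 : circleDist n (s * 3 ^ (j + 3)) + 3 * circleDist n (s * 3 ^ (j + 2)) = n := by
    have := circleDist_step hn s (j + 2)
    simp only [add_assoc, Nat.reduceAdd] at this
    omega
  have s3 := circleDist_step hn s (j + 3)
  simp only [add_assoc, Nat.reduceAdd] at s3
  omega

lemma gt_fifth_of_forall_gt {n m t δ s : ℕ} (hm : n + 1 = 3 ^ m) (hm2 : m % 4 = 2)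
    (hnt : n + 1 = 81 * t) (hδ : 5 * δ + 2 * t = n)
    (h : ∀ j, δ < circleDist n (s * 3 ^ j)) (j : ℕ) : n < 5 * circleDist n (s * 3 ^ j) := by
  by_contra hj
  -- The two relations on `t` force `n % 5 = 3`, which excludes equality.
  replace hj : 5 * circleDist n (s * 3 ^ j) < n := by omega
  have hfour : ∀ k, 5 * circleDist n (s * 3 ^ (j + 4 * k)) < n := by
    intro k
    induction k with
    | zero => exact hj
    | succ k ih => exact (lt_fifth_four_steps hnt hδ h ih).2
  have h2 := (lt_fifth_four_steps hnt hδ h hj).1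
  have hk := hfour ((m + 2) / 4)
  have e : j + 4 * ((m + 2) / 4) = j + 2 + m := by omega
  rw [e, circleDist_add_period hm] at hk
  omega

/-- After four steps the deviation `5 * y j - n` of the orbit, initially `-2 * t`, is only `2`. -/
lemma orbit_first_steps {n t δ s : ℕ} (hnt : n + 1 = 81 * t) (ht : 9 ≤ t)
    (hδ : 5 * δ + 2 * t = n) (hs : circleDist n s = δ) :
    δ < circleDist n (s * 3 ^ 1) ∧ δ < circleDist n (s * 3 ^ 2) ∧ δ < circleDist n (s * 3 ^ 3) ∧
      5 * circleDist n (s * 3 ^ 4) = n + 2 := by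
  have hn : 0 < n := by omega
  have e1 : circleDist n (s * 3 ^ 1) + 3 * δ = n := by
    have := circleDist_step hn s 0
    simp only [pow_zero, mul_one, zero_add, hs] at this
    rw [pow_one]
    simp only [pow_one] at this
    omega
  have e2 : circleDist n (s * 3 ^ 2) + n = 3 * circleDist n (s * 3 ^ 1) := by
    have := circleDist_step hn s 1
    simp only [Nat.reduceAdd] at this
    omega
  have e3 : circleDist n (s * 3 ^ 3) + 3 * circleDist n (s * 3 ^ 2) = n := by
    have := circleDist_step hn s 2
    simp only [Nat.reduceAdd] at this
    omega
  have s3 := circleDist_step hn s 3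
  simp only [Nat.reduceAdd] at s3
  omega

lemma nine_mul_abs_neg_nine_pow_le {k t r : ℕ} (ht : t = 3 ^ r) (h : 2 * (k + 1) ≤ r) :
    9 * |(-9 : ℤ) ^ k| ≤ t := by
  have h1 : (9 : ℕ) ^ (k + 1) ≤ t := by
    rw [ht, show 9 = 3 ^ 2 by norm_num, ← pow_mul]
    exact Nat.pow_le_pow_right (by norm_num) h
  rw [abs_pow, abs_neg, abs_of_pos (by norm_num : (0 : ℤ) < 9), ← pow_succ']
  exact_mod_cast h1

lemma orbit_two_steps {n t s j : ℕ} {p : ℤ} (hnt : n + 1 = 81 * t) (ht : 9 ≤ t)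
    (hp : 9 * |p| ≤ t) (hj : (5 * circleDist n (s * 3 ^ j) : ℤ) = n + 2 * p) :
    (5 * circleDist n (s * 3 ^ (j + 1)) : ℤ) = 2 * n - 6 * p ∧
      (5 * circleDist n (s * 3 ^ (j + 2)) : ℤ) = n - 18 * p := by
  have hn : 0 < n := by omega
  have s0 := circleDist_step hn s j
  have s1 := circleDist_step hn s (j + 1)
  have hp1 := le_abs_self p
  have hp2 := neg_abs_le p
  simp only [add_assoc, Nat.reduceAdd] at s1
  have e1 : (5 * circleDist n (s * 3 ^ (j + 1)) : ℤ) = 2 * n - 6 * p := by omega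
  refine ⟨e1, by omega⟩

lemma orbit_even {n m t δ s : ℕ} (hm : t = 3 ^ (m - 4)) (hnt : n + 1 = 81 * t) (ht : 9 ≤ t)
    (hδ : 5 * δ + 2 * t = n) (hs : circleDist n s = δ) (k : ℕ) (hk : 2 * k ≤ m - 4) :
    (5 * circleDist n (s * 3 ^ (4 + 2 * k)) : ℤ) = n + 2 * (-9) ^ k := by
  induction k with
  | zero =>
    have := (orbit_first_steps hnt ht hδ hs).2.2.2
    simp only [mul_zero, add_zero, pow_zero, mul_one]
    exact_mod_cast this
  | succ k ih =>
    have := (orbit_two_steps hnt ht (nine_mul_abs_neg_nine_pow_le hm hk) (ih (by omega))).2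
    rw [show 4 + 2 * (k + 1) = 4 + 2 * k + 2 by ring, this]
    ring

/-- The orbit of a point at distance `δ` from `0` stays above `δ` until it closes up. -/
lemma orbit_gt_of_lt_period {n m t δ s : ℕ} (hm : t = 3 ^ (m - 4)) (hm2 : m % 2 = 0)
    (hnt : n + 1 = 81 * t) (ht : 9 ≤ t) (hδ : 5 * δ + 2 * t = n) (hs : circleDist n s = δ)
    {j : ℕ} (hj0 : 0 < j) (hjm : j < m) : δ < circleDist n (s * 3 ^ j) := by
  obtain ⟨h1, h2, h3, -⟩ := orbit_first_steps hnt ht hδ hs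
  by_cases hj4 : j < 4
  · interval_cases j <;> assumption
  obtain ⟨k, hk⟩ : ∃ k, j = 4 + 2 * k ∨ j = 4 + 2 * k + 1 := ⟨(j - 4) / 2, by omega⟩
  have hp := nine_mul_abs_neg_nine_pow_le (k := k) hm (by omega)
  have heven := orbit_even hm hnt ht hδ hs k (by omega)
  have hodd := (orbit_two_steps hnt ht hp heven).1
  have hp1 := le_abs_self ((-9 : ℤ) ^ k)
  have hp2 := neg_abs_le ((-9 : ℤ) ^ k)
  rcases hk with rfl | rfl <;> omega

lemma ncard_cyclotomicCoset_of_orbit_ne {n m s : ℕ} (hm0 : m ≠ 0) (hm : n + 1 = 3 ^ m)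
    (h : ∀ j, 0 < j → j < m → circleDist n (s * 3 ^ j) ≠ circleDist n s) :
    (cyclotomicCoset 3 n s).ncard = m := by
  have himage : cyclotomicCoset 3 n s = (fun j => s * 3 ^ j % n) '' (Finset.range m : Set ℕ) := by
    ext k
    constructor
    · rintro ⟨j, rfl⟩
      exact ⟨j % m, by simpa using Nat.mod_lt j (Nat.pos_of_ne_zero hm0),
        (mul_pow_mod_period hm s j).symm⟩
    · rintro ⟨j, -, rfl⟩
      exact ⟨j, rfl⟩
  have hcop : Nat.Coprime n 3 := by
    have h1 : Nat.Coprime n (n + 1) := by simp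
    rw [hm] at h1
    exact Nat.Coprime.coprime_dvd_right (dvd_pow_self 3 hm0) h1
  have hlt : ∀ i j, i < j → j < m → s * 3 ^ i % n ≠ s * 3 ^ j % n := by
    intro i j hij hj heq
    have hmod : s * 3 ^ (j - i) ≡ s [MOD n] := by
      refine Nat.ModEq.cancel_right_of_coprime (c := 3 ^ i) (hcop.pow_right i) ?_
      rw [mul_assoc, ← pow_add, Nat.sub_add_cancel hij.le]
      exact heq.symm
    refine h (j - i) (by omega) (by omega) ?_
    rw [← circleDist_mod, hmod, circleDist_mod]
  rw [himage, Set.InjOn.ncard_image, Set.ncard_coe_finset, Finset.card_range]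
  intro i hi j hj heq
  simp only [Finset.coe_range, Set.mem_Iio] at hi hj
  by_contra hne
  rcases Nat.lt_or_gt_of_ne hne with hij | hij
  · exact hlt i j hij hj heq
  · exact hlt j i hij hi heq.symm

/-! ### The third largest absolute coset leader -/

theorem theorem3p3 (m n : ℕ) (hn : n = 3 ^ m - 1) :
    (m ≡ 0 [MOD 4] → 4 ≤ m → 5 ∣ 3 ^ m - 1 ∧ ∀ δ : ℕ, δ = (3 ^ m - 1) / 5 →
      IsKthLargest 3 (absCosetLeaders 3 n) δ ∧
      cyclotomicCoset 3 n δ = {δ, 2 * δ, n - 2 * δ, n - δ} ∧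
      (cyclotomicCoset 3 n δ).ncard = 4) ∧
    (m ≡ 2 [MOD 4] → 6 ≤ m → 5 ∣ 3 ^ (m - 6) - 1 ∧ ∀ δ : ℕ,
      δ = (3 ^ (m - 6) - 1) / 5 + 3 ^ (m - 6) + 2 * 3 ^ (m - 5) + 2 * 3 ^ (m - 3)
          + 3 ^ (m - 2) →
      IsKthLargest 3 (absCosetLeaders 3 n) δ ∧
      cyclotomicCoset 3 n δ ≠ cyclotomicCoset 3 n (n - δ) ∧
      (cyclotomicCoset 3 n δ).ncard = m ∧
      (cyclotomicCoset 3 n (n - δ)).ncard = m) := by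
  -- `80 = 3 ^ 4 - 1` supplies both the factor `5` and the factor `4`.
  have h81 : ∀ k, 3 ^ (4 * k) % 80 = 1 := fun k => by
    rw [pow_mul, Nat.pow_mod]; norm_num
  constructor
  · intro hmod hm4
    have hdiv : 3 ^ m % 80 = 1 := by
      obtain ⟨k, rfl⟩ : ∃ k, m = 4 * k := ⟨m / 4, by have : m % 4 = 0 := hmod; omega⟩
      exact h81 k
    have hbig : 3 ^ 4 ≤ 3 ^ m := Nat.pow_le_pow_right (by norm_num) hm4
    have hm : n + 1 = 3 ^ m := by omega
    rw [← hn]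
    refine ⟨by omega, ?_⟩
    intro δ hδ
    have h5 : n = 5 * δ := by omega
    have hδ0 : 0 < δ := by omega
    refine ⟨isKthLargest_three (by omega) hm (by omega) (by omega) (by omega)
      (h5 ▸ fifth_mem_absCosetLeaders hδ0) fun s hs j => ?_, ?_, ?_⟩
    · have := hs j
      omega
    · rw [h5]
      exact cyclotomicCoset_fifth
    · rw [h5]
      exact ncard_cyclotomicCoset_fifth hδ0
  · intro hmod hm6
    have hm2 : m % 4 = 2 := hmod
    obtain ⟨r, rfl⟩ : ∃ r, m = r + 6 := ⟨m - 6, by omega⟩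
    have hdiv : 3 ^ r % 80 = 1 := by
      obtain ⟨k, rfl⟩ : ∃ k, r = 4 * k := ⟨r / 4, by omega⟩
      exact h81 k
    simp only [show r + 6 - 6 = r by omega, show r + 6 - 5 = r + 1 by omega,
      show r + 6 - 3 = r + 3 by omega, show r + 6 - 2 = r + 4 by omega]
    refine ⟨by omega, ?_⟩
    intro δ hδ
    have ht : 9 * 3 ^ r = 3 ^ (r + 6 - 4) := by
      rw [show r + 6 - 4 = r + 2 by omega, pow_add]; ring
    have hpos : 0 < 3 ^ r := by positivity
    have hm : n + 1 = 3 ^ (r + 6) := by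
      have : 0 < 3 ^ (r + 6) := by positivity
      omega
    have hnt : n + 1 = 81 * (9 * 3 ^ r) := by rw [hm, pow_add]; ring
    have hδn : 5 * δ + 2 * (9 * 3 ^ r) = n := by
      rw [pow_add, pow_add, pow_add] at hδ
      omega
    have ht9 : 9 ≤ 9 * 3 ^ r := by omega
    have hself : circleDist n δ = δ := circleDist_of_two_mul_le (by omega) (by omega)
    have hneg : circleDist n (n - δ) = δ := by
      have : (n - δ) % n = n - δ := Nat.mod_eq_of_lt (by omega)
      unfold circleDist
      omega
    have horbit : ∀ s, circleDist n s = δ → ∀ j, 0 < j → j < r + 6 →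
        δ < circleDist n (s * 3 ^ j) := fun s hs j hj0 hjm =>
      orbit_gt_of_lt_period ht (by omega) hnt ht9 hδn hs hj0 hjm
    have hcard : ∀ s, circleDist n s = δ → (cyclotomicCoset 3 n s).ncard = r + 6 := fun s hs =>
      ncard_cyclotomicCoset_of_orbit_ne (by omega) hm fun j hj0 hjm => by
        rw [hs]; exact (horbit s hs j hj0 hjm).ne'
    refine ⟨?_, ?_, hcard δ hself, hcard _ hneg⟩
    · refine isKthLargest_three (by omega) hm (by omega) (by omega) (by omega) ?_ fun s hs =>
        gt_fifth_of_forall_gt hm hm2 hnt hδn hs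
      refine mem_absCosetLeaders (by omega) (by omega) fun j => ?_
      rw [circleDist_mod_period hm]
      have hlt : j % (r + 6) < r + 6 := Nat.mod_lt _ (by omega)
      rcases Nat.eq_zero_or_pos (j % (r + 6)) with h0 | h0
      · rw [h0, pow_zero, mul_one, hself]
      · exact (horbit δ hself _ h0 hlt).le
    · intro heq
      have hmem : n - δ ∈ cyclotomicCoset 3 n δ := by
        rw [heq]
        exact ⟨0, by rw [pow_zero, mul_one, Nat.mod_eq_of_lt (by omega)]⟩
      obtain ⟨j, hj⟩ := hmem
      rw [mul_pow_mod_period hm] at hj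
      have hlt : j % (r + 6) < r + 6 := Nat.mod_lt _ (by omega)
      rcases Nat.eq_zero_or_pos (j % (r + 6)) with h0 | h0
      · rw [h0, pow_zero, mul_one, Nat.mod_eq_of_lt (by omega)] at hj
        omega
      · -- `n - δ` is at distance `δ` from `0`, but inside a period the orbit of `δ` is farther away.
        have := horbit δ hself _ h0 hlt
        rw [← circleDist_mod, ← hj, hneg] at this
        exact this.false
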